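/- **Setting.** There are buses $i\in\mathcal I$ ($|\mathcal I|=I$), periods $t\in\mathcal T=\{1,\dots,T\}$ and transmission lines $l\in\mathcal L$. Given are real numbers $C^{\rm o}_i,C^{\rm u}_i,C^{\rm d}_i,C^{\rm g}_i,C^{\rm l}_{it},C^{\rm r}_{it}$ (costs), $\underline X_i,\overline X_i,X^{\rm rd}_i,X^{\rm sd}_i,X^{\rm ru}_i,X^{\rm su}_i$ (output and ramping limits), $d_{it}$ (loads), $w^{\rm f}_{it}$ (forecasts), $W_i$ (capacities), $F_l,F_{il}$ (line data), natural numbers $T^{\rm u}_i,T^{\rm d}_i$ (minimum up and down times), and initial values $u^{\rm o}_{i0}$ and $x^{\rm g}_{i0}=\overline x^{\rm g}_{i0}=\underline x^{\rm g}_{i0}$. Let $\mathcal U$ be the set of $\mathbf u=(u^{\rm o}_{it},u^{\rm u}_{it},u^{\rm d}_{it})_{i,t}$ with entries in $\{0,1\}$ such that for all $i,t$: $u^{\rm u}_{it}\ge u^{\rm o}_{it}-u^{\rm o}_{i(t-1)}$, $u^{\rm d}_{it}\ge -u^{\rm o}_{it}+u^{\rm o}_{i(t-1)}$, $u^{\rm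 o}_{it}+u^{\rm d}_{it}\le 1$, $u^{\rm o}_{i(t-1)}+u^{\rm u}_{it}\le 1$, $u^{\rm o}_{it}-u^{\rm o}_{i(t-1)}\le u^{\rm o}_{i\tau}$ for $t\le\tau\le\min\{t-1+T^{\rm u}_i,T\}$, and $u^{\rm o}_{i(t-1)}-u^{\rm o}_{it}\le 1-u^{\rm o}_{i\tau}$ for $t\le\tau\le\min\{t-1+T^{\rm d}_i,T\}$. Put $\mathbf c_1^\top\mathbf u=\sum_{i,t}(C^{\rm o}_iu^{\rm o}_{it}+C^{\rm u}_iu^{\rm u}_{it}+C^{\rm d}_iu^{\rm d}_{it})$. Let $\mathcal X^{\rm r}(\mathbf u)$ be the set of $(\overline{\mathbf x},\underline{\mathbf x})=(\overline x^{\rm g}_{it},\underline x^{\rm g}_{it})_{i,t}$ such that for all $i,t$: $\underline X_iu^{\rm o}_{it}\le\underline x^{\rm g}_{it}\le\overline x^{\rm g}_{it}\le\overline X_iu^{\rm o}_{it}$, $\overline x^{\rm g}_{it}-\underline x^{\rm g}_{i(t-1)}\le X^{\rm ru}_iu^{\rm o}_{i(t-1)}+X^{\rm su}_iu^{\rm u}_{it}$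 and $\overline x^{\rm g}_{i(t-1)}-\underline x^{\rm g}_{it}\le X^{\rm rd}_iu^{\rm o}_{it}+X^{\rm sd}_iu^{\rm d}_{it}$. For $\mathbf w\in\mathbb R^{IT}$ let $\mathcal X(\overline{\mathbf x},\underline{\mathbf x},\mathbf w)$ be the set of real vectors $\mathbf x=(x^{\rm g}_{it},x^{\rm l}_{it},x^{\rm r}_{it})_{i,t}$ with $\underline x^{\rm g}_{it}\le x^{\rm g}_{it}\le\overline x^{\rm g}_{it}$, $0\le x^{\rm l}_{it}\le d_{it}$, $0\le x^{\rm r}_{it}\le w^{\rm f}_{it}+w_{it}$ for all $i,t$ and, with $p_{it}=x^{\rm g}_{it}-d_{it}+x^{\rm l}_{it}+w^{\rm f}_{it}+w_{it}-x^{\rm r}_{it}$, $-F_l\le\sum_iF_{il}\,p_{it}\le F_l$ for all $l,t$ and $\sum_ip_{it}=0$ for all $t$. Put $\mathbf c_2^\top\mathbf x=\sum_{i,t}(C^{\rm g}_ix^{\rm g}_{it}+C^{\rm l}_{it}x^{\rm l}_{it}+C^{\rm r}_{it}x^{\rm r}_{it})$ and $f(\overline{\mathbf x},\underline{\mathbf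 x},\mathbf w)=\min_{\mathbf x\in\mathcal X(\overline{\mathbf x},\underline{\mathbf x},\mathbf w)}\mathbf c_2^\top\mathbf x$. Let $\mathcal W=\prod_{i,t}[-w^{\rm f}_{it},W_i-w^{\rm f}_{it}]$, let $\hat{\mathbf w}^1,\dots,\hat{\mathbf w}^S\in\mathcal W$ ($S\ge1$) be samples, $\varepsilon\ge0$, $\beta\in\mathbb R$, $\mathbb P_{\rm e}=\frac1S\sum_s\delta_{\hat{\mathbf w}^s}$, and let $\Omega$ be the set of $\mathbf w\in\mathcal W$ with $\min_s\hat w^s_{it}-\varepsilon\max\{S,\beta\}\le w_{it}\le\max_s\hat w^s_{it}+\varepsilon\max\{S,\beta\}$ for all $i,t$. Let $\mathcal P_\varepsilon(\mathbb P_{\rm e},\Omega)$ be the set of probability distributions supported on $\Omega$ whose 1-Wasserstein distance to $\mathbb P_{\rm e}$ with respect to $\|\cdot\|_1$ is at most $\varepsilon$. Consider the exact Wasserstein distributionally robust unit commitment problem $$\text{(A)}\quad\min_{\mathbf u\in\mathcal U,\,(\overline{\mathbf x},\underline{\mathbf x})\in\mathcal X^{\rm r}(\mathbf u)}\Big\{\mathbf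 c_1^\top\mathbf u+\max_{\mathbb P\in\mathcal P_\varepsilon(\mathbb P_{\rm e},\Omega)}\mathbb E_{\mathbb P}[f(\overline{\mathbf x},\underline{\mathbf x},\mathbf w)]\Big\}\ \text{ s.t. }\ \mathcal X(\overline{\mathbf x},\underline{\mathbf x},\mathbf w)\ne\emptyset\ \ \forall\mathbf w\in\mathcal W,$$ and, with $\mathcal X^{\rm e}(\mathbf u)=\{(\overline{\mathbf x},\underline{\mathbf x})\in\mathcal X^{\rm r}(\mathbf u):\mathcal X(\overline{\mathbf x},\underline{\mathbf x},\mathbf w)\neq\emptyset\ \forall\mathbf w\in\mathcal W\}$, the problem $$\text{(B)}\quad\min_{\mathbf u\in\mathcal U,\,(\overline{\mathbf x},\underline{\mathbf x})\in\mathcal X^{\rm e}(\mathbf u),\,\lambda\ge0,\,\eta^s\in\mathbb R}\mathbf c_1^\top\mathbf u+\lambda\varepsilon+\frac1S\sum_{s}\eta^s\ \text{ s.t. }\ f(\overline{\mathbf x},\underline{\mathbf x},\mathbf w)-\lambda\|\mathbf w-\hat{\mathbf w}^s\|_1\le\eta^s\ \ \forall s,\ \forall\mathbf w\in\Omega.$$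 **Proposition.** Problem (A) is equivalently rewritten as problem (B). Precisely: at every feasible point $(\mathbf u,\overline{\mathbf x},\underline{\mathbf x})$ of (A), the minimum $f(\overline{\mathbf x},\underline{\mathbf x},\mathbf w)$ is attained for every $\mathbf w\in\mathcal W$, the function $f(\overline{\mathbf x},\underline{\mathbf x},\cdot)$ is integrable under every $\mathbb P\in\mathcal P_\varepsilon(\mathbb P_{\rm e},\Omega)$, the maximum over $\mathbb P$ is attained, and it equals the (attained) minimum of $\lambda\varepsilon+\frac1S\sum_s\eta^s$ over all $\lambda\ge0$ and $\eta^s$ that satisfy the constraints of (B). The optimal values (infima, $+\infty$ if infeasible) of (A) and (B) coincide; $(\mathbf u,\overline{\mathbf x},\underline{\mathbf x})$ is feasible for (A) if and only if it extends by some $(\lambda,\eta)$ to a feasible point of (B), and it is an optimal solution of (A) if and only if it extends by some $(\lambda,\eta)$ to an optimal solution of (B). -/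

import Mathlib

open MeasureTheory Set
open scoped ENNReal

noncomputable section

namespace UnitCommitment

/-- Real arrays indexed by the buses `i` and the time periods `t` (an element of `ℝ^{IT}`).
The periods `1, …, T` are the elements `0, …, T - 1` of `Fin T`. -/
abbrev Profile (I T : ℕ) : Type := Fin I → Fin T → ℝ

/-- The 1-norm on `ℝ^{IT}`. -/
def oneNorm {I T : ℕ} (w : Profile I T) : ℝ := ∑ i, ∑ t, |w i t|

/-- The value of `z` in the period before `t`; `z₀` is the value before the first period. -/
def prev {I T : ℕ} (z₀ : Fin I → ℝ) (z : Profile I T) (i : Fin I) (t : Fin T) : ℝ :=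
  if t.val = 0 then z₀ i else z i ⟨t.val - 1, lt_of_le_of_lt (Nat.sub_le _ _) t.isLt⟩

/-- The numerical data of a unit commitment instance with `I` buses, `T` periods, `L` lines. -/
structure Data (I T L : ℕ) where
  /-- no-load cost -/
  costOn : Fin I → ℝ
  /-- start-up cost -/
  costUp : Fin I → ℝ
  /-- shut-down cost -/
  costDown : Fin I → ℝ
  /-- marginal generation cost -/
  costGen : Fin I → ℝ
  /-- marginal load shedding cost -/
  costShed : Profile I T
  /-- marginal curtailment cost -/
  costCurt : Profile I T
  /-- minimum up time -/
  minUp : Fin I → ℕ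
  /-- minimum down time -/
  minDown : Fin I → ℕ
  /-- minimum power output -/
  genMin : Fin I → ℝ
  /-- maximum power output -/
  genMax : Fin I → ℝ
  /-- ramp-down limit -/
  rampDown : Fin I → ℝ
  /-- shut-down-ramp limit -/
  shutRamp : Fin I → ℝ
  /-- ramp-up limit -/
  rampUp : Fin I → ℝ
  /-- start-up-ramp limit -/
  startRamp : Fin I → ℝ
  /-- load -/
  load : Profile I T
  /-- renewable generation forecast -/
  forecast : Profile I T
  /-- capacity of the renewable generation systems -/
  capacity : Fin I → ℝ
  /-- line capacity -/
  lineCap : Fin L → ℝ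
  /-- power shift factor of a bus and a line -/
  shift : Fin I → Fin L → ℝ
  /-- on/off status before the first period -/
  onInit : Fin I → ℝ
  /-- power output before the first period -/
  genInit : Fin I → ℝ

/-- The commitment variables `u = (uᵒ, uᵘ, uᵈ)`. -/
structure Commitment (I T : ℕ) where
  /-- on/off status -/
  on : Profile I T
  /-- start-up status -/
  up : Profile I T
  /-- shut-down status -/
  down : Profile I T

/-- The dispatch variables `x = (xᵍ, xˡ, xʳ)`. -/
structure Dispatch (I T : ℕ) where
  /-- conventional generation -/
  gen : Profile I T
  /-- load shedding -/
  shed : Profile I T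
  /-- curtailment of renewable generation -/
  curt : Profile I T

/-- An allowable dispatch range: maximum and minimum allowable power outputs. -/
structure Range (I T : ℕ) where
  /-- maximum allowable power output -/
  hi : Profile I T
  /-- minimum allowable power output -/
  lo : Profile I T

namespace Data

variable {I T L : ℕ} (D : Data I T L)

/-- The fixed operating cost `c₁ᵀ u`. -/
def fixedCost (u : Commitment I T) : ℝ :=
  ∑ i, ∑ t, (D.costOn i * u.on i t + D.costUp i * u.up i t + D.costDown i * u.down i t)

/-- The variable operating cost `c₂ᵀ x`. -/
def variableCost (x : Dispatch I T) : ℝ :=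
  ∑ i, ∑ t, (D.costGen i * x.gen i t + D.costShed i t * x.shed i t
    + D.costCurt i t * x.curt i t)

/-- The set `𝒰` of feasible commitments. -/
def commitments : Set (Commitment I T) :=
  {u | ∀ i t,
    (u.on i t = 0 ∨ u.on i t = 1) ∧
    (u.up i t = 0 ∨ u.up i t = 1) ∧
    (u.down i t = 0 ∨ u.down i t = 1) ∧
    u.on i t - prev D.onInit u.on i t ≤ u.up i t ∧
    -u.on i t + prev D.onInit u.on i t ≤ u.down i t ∧
    u.on i t + u.down i t ≤ 1 ∧
    prev D.onInit u.on i t + u.up i t ≤ 1 ∧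
    (∀ τ : Fin T, t.val ≤ τ.val → τ.val < t.val + D.minUp i →
      u.on i t - prev D.onInit u.on i t ≤ u.on i τ) ∧
    (∀ τ : Fin T, t.val ≤ τ.val → τ.val < t.val + D.minDown i →
      prev D.onInit u.on i t - u.on i t ≤ 1 - u.on i τ)}

/-- The set `𝒳ʳ(u)` of dispatch ranges that respect the output and ramping limits. -/
def ranges (u : Commitment I T) : Set (Range I T) :=
  {r | ∀ i t,
    D.genMin i * u.on i t ≤ r.lo i t ∧
    r.lo i t ≤ r.hi i t ∧
    r.hi i t ≤ D.genMax i * u.on i t ∧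
    r.hi i t - prev D.genInit r.lo i t
      ≤ D.rampUp i * prev D.onInit u.on i t + D.startRamp i * u.up i t ∧
    prev D.genInit r.hi i t - r.lo i t
      ≤ D.rampDown i * u.on i t + D.shutRamp i * u.down i t}

/-- The net power injection at bus `i` in period `t`. -/
def injection (w : Profile I T) (x : Dispatch I T) (i : Fin I) (t : Fin T) : ℝ :=
  x.gen i t - D.load i t + x.shed i t + D.forecast i t + w i t - x.curt i t

/-- The set `𝒳(x̄, x̲, w)` of dispatches feasible for the range `r` and forecast error `w`. -/
def dispatches (r : Range I T) (w : Profile I T) : Set (Dispatch I T) :=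
  {x | (∀ i t, r.lo i t ≤ x.gen i t ∧ x.gen i t ≤ r.hi i t) ∧
    (∀ i t, 0 ≤ x.shed i t ∧ x.shed i t ≤ D.load i t) ∧
    (∀ i t, 0 ≤ x.curt i t ∧ x.curt i t ≤ D.forecast i t + w i t) ∧
    (∀ l t, -D.lineCap l ≤ ∑ i, D.shift i l * D.injection w x i t ∧
      ∑ i, D.shift i l * D.injection w x i t ≤ D.lineCap l) ∧
    (∀ t, ∑ i, D.injection w x i t = 0)}

/-- The optimal dispatch cost `f(x̄, x̲, w)`. It is only used where `dispatches r w` is nonempty,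
so that the default value of `sInf` at the empty set plays no role. -/
def dispatchCost (r : Range I T) (w : Profile I T) : ℝ :=
  sInf (D.variableCost '' D.dispatches r w)

/-- The uncertainty set `𝒲`, a box. -/
def uncertaintySet : Set (Profile I T) :=
  {w | ∀ i t, -D.forecast i t ≤ w i t ∧ w i t ≤ D.capacity i - D.forecast i t}

/-- The set `𝒳ᵉ(u)`: the ranges in `𝒳ʳ(u)` that admit a feasible dispatch for all `w ∈ 𝒲`. -/
def robustRanges (u : Commitment I T) : Set (Range I T) :=
  {r | r ∈ D.ranges u ∧ ∀ w ∈ D.uncertaintySet, (D.dispatches r w).Nonempty}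

end Data

/-- The empirical distribution of the samples. -/
def empirical {I T S : ℕ} (sample : Fin S → Profile I T) : Measure (Profile I T) :=
  (S : ℝ≥0∞)⁻¹ • ∑ s, Measure.dirac (sample s)

/-- The joint distributions with marginals `P` and `Q`. -/
def couplings {I T : ℕ} (P Q : Measure (Profile I T)) :
    Set (Measure (Profile I T × Profile I T)) :=
  {π | π.map Prod.fst = P ∧ π.map Prod.snd = Q}

/-- The 1-Wasserstein distance with respect to the 1-norm. -/
def wassersteinDist {I T : ℕ} (P Q : Measure (Profile I T)) : ℝ≥0∞ :=
  ⨅ π ∈ couplings P Q, ∫⁻ z, ENNReal.ofReal (oneNorm (z.1 - z.2)) ∂π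

/-- The Wasserstein ball of radius `ε` around `Q` in the probability distributions on `Ω`. -/
def wassersteinBall {I T : ℕ} (ε : ℝ) (Q : Measure (Profile I T)) (Ω : Set (Profile I T)) :
    Set (Measure (Profile I T)) :=
  {P | IsProbabilityMeasure P ∧ P Ωᶜ = 0 ∧ wassersteinDist P Q ≤ ENNReal.ofReal ε}

namespace Data

variable {I T L S : ℕ} (D : Data I T L) (sample : Fin S → Profile I T) (ε β : ℝ)

/-- The subset `Ω = 𝒲 ∩ [w̲ᵃ, w̄ᵃ]` of the uncertainty set. -/
def omega : Set (Profile I T) :=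
  {w | w ∈ D.uncertaintySet ∧ ∀ i t,
    (⨅ s, sample s i t) - ε * max (S : ℝ) β ≤ w i t ∧
    w i t ≤ (⨆ s, sample s i t) + ε * max (S : ℝ) β}

/-- The ambiguity set `𝒫_ε(ℙₑ, Ω)`. -/
def ambiguitySet : Set (Measure (Profile I T)) :=
  wassersteinBall ε (empirical sample) (D.omega sample ε β)

/-- The expected optimal dispatch costs of the range `r` over the ambiguity set. -/
def expectedCosts (r : Range I T) : Set ℝ :=
  (fun P : Measure (Profile I T) => ∫ w, D.dispatchCost r w ∂P) '' D.ambiguitySet sample ε β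

/-- The feasible set of the distributionally robust problem. -/
def drFeasible : Set (Commitment I T × Range I T) :=
  {p | p.1 ∈ D.commitments ∧ p.2 ∈ D.ranges p.1 ∧
    ∀ w ∈ D.uncertaintySet, (D.dispatches p.2 w).Nonempty}

/-- The objective function of the distributionally robust problem. -/
def drObjective (p : Commitment I T × Range I T) : ℝ :=
  D.fixedCost p.1 + sSup (D.expectedCosts sample ε β p.2)

/-- The pairs `(lam, η)` feasible for the second part of the reformulation at the range `r`. -/
def multipliers (r : Range I T) : Set (ℝ × (Fin S → ℝ)) :=
  {m | 0 ≤ m.1 ∧ ∀ s, ∀ w ∈ D.omega sample ε β,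
    D.dispatchCost r w - m.1 * oneNorm (w - sample s) ≤ m.2 s}

/-- The cost `lam * ε + (1 / S) * ∑ η` of a pair `(lam, η)`. -/
def multiplierCost (m : ℝ × (Fin S → ℝ)) : ℝ :=
  m.1 * ε + 1 / (S : ℝ) * ∑ s, m.2 s

/-- The feasible set of the reformulation, in the variables `((u, r), (lam, η))`. -/
def roFeasible : Set ((Commitment I T × Range I T) × (ℝ × (Fin S → ℝ))) :=
  {q | q.1.1 ∈ D.commitments ∧ q.1.2 ∈ D.robustRanges q.1.1 ∧
    q.2 ∈ D.multipliers sample ε β q.1.2}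

/-- The objective function of the reformulation. -/
def roObjective (q : (Commitment I T × Range I T) × (ℝ × (Fin S → ℝ))) : ℝ :=
  D.fixedCost q.1.1 + multiplierCost ε q.2

end Data

end UnitCommitment

end

/-! Fix a feasible point of (A). The claim reduces to strong duality, with both optima attained, for
the worst-case expectation of `f = dispatchCost r` over the Wasserstein ball; passing to the outer
minimization is then formal.

Regularity of `f`: the triples (error, cost bound, dispatch) form a polyhedron, and Fourier–Motzkin
elimination of the dispatch shows that the epigraph of `f` is polyhedral too. Hence `f` is Lipschitz
wherever dispatches exist (`exists_lipschitz_of_epigraph`).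

Weak duality integrates the constraints on `(lam, η)` against a nearly optimal coupling. For the
converse, send one point of `Ω` per sample to the pair (mean transport cost, mean value of `f`). The
image of `Ω^S` is a compact set `G` in the plane. Maximizing the second coordinate over its convex
hull, with the first at most `ε`, gives a point that is a finite mixture of scenarios, hence a
discrete worst-case distribution (`exists_mem_wassersteinBall`), and a Lagrange multiplier `lam`
(`IsCompact.exists_lagrange_multiplier`). Since `Ω^S` is a product, the Lagrangian splits over the
samples and its maxima are the `η s`. -/

/-! ### Polyhedral sets, Fourier–Motzkin elimination and Lipschitz value functions -/

/-- A finite intersection of closed half-spaces. -/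
def IsPolyhedral {V : Type*} [AddCommGroup V] [Module ℝ V] (s : Set V) : Prop :=
  ∃ (ι : Type) (_ : Fintype ι) (φ : ι → V →ₗ[ℝ] ℝ) (b : ι → ℝ), s = {v | ∀ k, φ k v ≤ b k}

/-- The sum of a linear functional and a constant. -/
def IsAffineFunction {V : Type*} [AddCommGroup V] [Module ℝ V] (g : V → ℝ) : Prop :=
  ∃ (φ : V →ₗ[ℝ] ℝ) (c : ℝ), ∀ v, g v = φ v + c

namespace IsAffineFunction

variable {V : Type*} [AddCommGroup V] [Module ℝ V] {g h : V → ℝ}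

theorem linear (φ : V →ₗ[ℝ] ℝ) : IsAffineFunction (fun v => φ v) := ⟨φ, 0, by simp⟩

theorem const (c : ℝ) : IsAffineFunction (fun _ : V => c) := ⟨0, c, by simp⟩

theorem add (hg : IsAffineFunction g) (hh : IsAffineFunction h) :
    IsAffineFunction (fun v => g v + h v) := by
  obtain ⟨φ, c, hg⟩ := hg
  obtain ⟨ψ, d, hh⟩ := hh
  exact ⟨φ + ψ, c + d, fun v => by simp [hg, hh]; ring⟩

theorem const_mul (a : ℝ) (hg : IsAffineFunction g) : IsAffineFunction (fun v => a * g v) := by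
  obtain ⟨φ, c, hg⟩ := hg
  exact ⟨a • φ, a * c, fun v => by simp [hg]; ring⟩

theorem sub (hg : IsAffineFunction g) (hh : IsAffineFunction h) :
    IsAffineFunction (fun v => g v - h v) := by
  simpa [sub_eq_add_neg] using hg.add (hh.const_mul (-1))

theorem sum {ι : Type*} (s : Finset ι) {g : ι → V → ℝ} (hg : ∀ i, IsAffineFunction (g i)) :
    IsAffineFunction (fun v => ∑ i ∈ s, g i v) := by
  classical
  induction s using Finset.induction_on with
  | empty => simpa using const (V := V) 0
  | insert i s hi ih => simpa [Finset.sum_insert hi] using (hg i).add ih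

theorem isPolyhedral_le (hg : IsAffineFunction g) (hh : IsAffineFunction h) :
    IsPolyhedral {v | g v ≤ h v} := by
  obtain ⟨φ, c, hg⟩ := hg
  obtain ⟨ψ, d, hh⟩ := hh
  refine ⟨Unit, inferInstance, fun _ => φ - ψ, fun _ => d - c, ?_⟩
  ext v
  simp only [mem_ofPred_eq, hg, hh, LinearMap.sub_apply, forall_const]
  constructor <;> intro h <;> linarith

end IsAffineFunction

namespace IsPolyhedral

variable {V V' : Type*} [AddCommGroup V] [Module ℝ V] [AddCommGroup V'] [Module ℝ V']

theorem univ : IsPolyhedral (Set.univ : Set V) :=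
  ⟨Empty, inferInstance, fun _ => 0, fun _ => 0, by ext v; simp⟩

theorem all {κ : Type} [Fintype κ] {p : κ → V → Prop} (h : ∀ i, IsPolyhedral {v | p i v}) :
    IsPolyhedral {v | ∀ i, p i v} := by
  choose ι hι φ b h using h
  refine ⟨Σ i, ι i, inferInstance, fun k => φ k.1 k.2, fun k => b k.1 k.2, ?_⟩
  ext v
  have : ∀ i, p i v ↔ ∀ k, φ i k v ≤ b i k := fun i => Set.ext_iff.1 (h i) v
  simp [this, Sigma.forall]

theorem and {p q : V → Prop} (hp : IsPolyhedral {v | p v}) (hq : IsPolyhedral {v | q v}) :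
    IsPolyhedral {v | p v ∧ q v} := by
  have := all (V := V) (κ := Bool) (p := fun i v => bif i then p v else q v)
    (by rintro (_ | _) <;> simpa)
  simpa [Bool.forall_bool, and_comm] using this

theorem imp {p : Prop} {q : V → Prop} (h : p → IsPolyhedral {v | q v}) :
    IsPolyhedral {v | p → q v} := by
  by_cases hp : p
  · simpa [hp] using h hp
  · simpa [hp] using univ (V := V)

theorem preimage {s : Set V'} (hs : IsPolyhedral s) (f : V →ₗ[ℝ] V') :
    IsPolyhedral {v | f v ∈ s} := by
  obtain ⟨ι, hι, φ, b, rfl⟩ := hs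
  exact ⟨ι, hι, fun k => φ k ∘ₗ f, b, by ext v; simp⟩

end IsPolyhedral

theorem Finset.exists_between_of_forall_le {ι : Type*} (N P : Finset ι) (a b : ι → ℝ)
    (h : ∀ l ∈ N, ∀ k ∈ P, a l ≤ b k) : ∃ y, (∀ l ∈ N, a l ≤ y) ∧ ∀ k ∈ P, y ≤ b k := by
  rcases N.eq_empty_or_nonempty with rfl | hN
  · rcases P.eq_empty_or_nonempty with rfl | hP
    · exact ⟨0, by simp, by simp⟩
    · exact ⟨P.inf' hP b, by simp, fun k hk => Finset.inf'_le _ hk⟩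
  · exact ⟨N.sup' hN a, fun l hl => Finset.le_sup' a hl,
      fun k hk => Finset.sup'_le _ _ fun l hl => h l hl k hk⟩

namespace IsPolyhedral

variable {V V' : Type*} [AddCommGroup V] [Module ℝ V] [AddCommGroup V'] [Module ℝ V']

/-- Fourier–Motzkin elimination of one variable. -/
theorem exists_add_smul_mem {s : Set V} (hs : IsPolyhedral s) (e : V) :
    IsPolyhedral {v | ∃ y : ℝ, v + y • e ∈ s} := by
  classical
  obtain ⟨ι, hι, φ, b, rfl⟩ := hs
  -- Rows with `φ k e < 0` bound `y` from below, rows with `0 < φ k e` from above. A suitable `y`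
  -- exists iff every lower bound is at most every upper bound, which is the cross-multiplied
  -- inequality.
  have key : {v | ∃ y : ℝ, v + y • e ∈ {v | ∀ k, φ k v ≤ b k}} =
      {v | (∀ k, φ k e = 0 → φ k v ≤ b k) ∧ ∀ k l, φ k e < 0 → 0 < φ l e →
        φ l e * φ k v + (-φ k e) * φ l v ≤ φ l e * b k + (-φ k e) * b l} := by
    ext v
    simp only [mem_ofPred_eq, map_add, map_smul, smul_eq_mul]
    constructor
    · rintro ⟨y, hy⟩
      refine ⟨fun k hk => by simpa [hk] using hy k, fun k l hk hl => ?_⟩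
      have h1 := mul_le_mul_of_nonneg_left (hy k) hl.le
      have h2 := mul_le_mul_of_nonneg_left (hy l) (neg_pos.2 hk).le
      linarith
    · rintro ⟨h0, h1⟩
      obtain ⟨y, hN, hP⟩ := Finset.exists_between_of_forall_le
        (Finset.univ.filter fun k => φ k e < 0) (Finset.univ.filter fun k => 0 < φ k e)
        (fun k => (b k - φ k v) / φ k e) (fun k => (b k - φ k v) / φ k e) (by
          intro k hk l hl
          simp only [Finset.mem_filter, Finset.mem_univ, true_and] at hk hl
          rw [div_le_iff_of_neg hk, div_mul_eq_mul_div, div_le_iff₀ hl]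
          linarith [h1 k l hk hl])
      refine ⟨y, fun k => ?_⟩
      rcases lt_trichotomy (φ k e) 0 with hk | hk | hk
      · have := hN k (by simpa using hk)
        rw [div_le_iff_of_neg hk] at this
        linarith
      · simpa [hk] using h0 k hk
      · have := hP k (by simpa using hk)
        rw [le_div_iff₀ hk] at this
        linarith
  rw [key]
  have hφ : ∀ k, IsAffineFunction fun v => φ k v := fun k => .linear _
  refine .and (.all fun k => .imp fun _ => (hφ k).isPolyhedral_le (.const _))
    (.all fun k => .all fun l => .imp fun _ => .imp fun _ => ?_)
  exact (((hφ k).const_mul _).add ((hφ l).const_mul _)).isPolyhedral_le (.const _)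

/-- One direction is eliminated at a time; the directions need not be independent. -/
theorem exists_add_sum_smul_mem {s : Set V} (hs : IsPolyhedral s) {ι : Type*} (J : Finset ι)
    (e : ι → V) : IsPolyhedral {v | ∃ x : ι → ℝ, v + ∑ i ∈ J, x i • e i ∈ s} := by
  classical
  induction J using Finset.induction_on with
  | empty => simpa using hs
  | insert i J hi ih =>
    convert ih.exists_add_smul_mem (e i) using 1
    ext v
    simp only [mem_ofPred_eq, Finset.sum_insert hi]
    constructor
    · rintro ⟨x, hx⟩
      exact ⟨x i, x, by rwa [add_assoc]⟩
    · rintro ⟨y, x, hx⟩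
      refine ⟨Function.update x i y, ?_⟩
      rw [Function.update_self, ← add_assoc]
      convert hx using 3 with j hj
      rw [Function.update_of_ne (by rintro rfl; exact hi hj)]

/-- The projection of a polyhedral set along a finite-dimensional space is polyhedral. -/
theorem exists_mk_mem [FiniteDimensional ℝ V'] {s : Set (V × V')} (hs : IsPolyhedral s) :
    IsPolyhedral {v | ∃ x : V', (v, x) ∈ s} := by
  let B := Module.finBasis ℝ V'
  convert (hs.exists_add_sum_smul_mem Finset.univ fun i => ((0 : V), B i)).preimage
    (LinearMap.inl ℝ V V') using 1
  ext v
  have (x : Fin (Module.finrank ℝ V') → ℝ) :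
      LinearMap.inl ℝ V V' v + ∑ i, x i • ((0 : V), B i) = (v, ∑ i, x i • B i) := by
    ext <;> simp [Prod.fst_sum, Prod.snd_sum]
  simp only [mem_ofPred_eq, this]
  constructor
  · rintro ⟨x, hx⟩
    exact ⟨B.repr x, by rwa [B.sum_repr]⟩
  · rintro ⟨x, hx⟩
    exact ⟨_, hx⟩

/-- A function whose epigraph over `W` is cut out by a polyhedral set is Lipschitz on `W`. -/
theorem exists_lipschitz_of_epigraph {E : Type*} [NormedAddCommGroup E] [NormedSpace ℝ E]
    [FiniteDimensional ℝ E] {Q : Set (E × ℝ)} (hQ : IsPolyhedral Q) {W : Set E} {f : E → ℝ}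
    (h : ∀ w ∈ W, ∀ t, (w, t) ∈ Q ↔ f w ≤ t) :
    ∃ C, 0 ≤ C ∧ ∀ w ∈ W, ∀ w' ∈ W, f w ≤ f w' + C * ‖w - w'‖ := by
  obtain ⟨ι, hι, φ, b, rfl⟩ := hQ
  let ψ : ι → E →L[ℝ] ℝ := fun k => (φ k ∘ₗ LinearMap.inl ℝ E ℝ).toContinuousLinearMap
  let α : ι → ℝ := fun k => φ k (0, 1)
  have hφ : ∀ k w t, φ k (w, t) = ψ k w + α k * t := by
    intro k w t
    have : (w, t) = LinearMap.inl ℝ E ℝ w + t • ((0 : E), (1 : ℝ)) := by ext <;> simp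
    rw [this, map_add, map_smul, smul_eq_mul, mul_comm]
    rfl
  simp only [mem_ofPred_eq, hφ] at h
  have hC : ∀ k, 0 ≤ ‖ψ k‖ / |α k| := fun k => by positivity
  -- A row with `α k < 0` reads `t ≥ (ψ k w - b k) / |α k|`, a Lipschitz lower bound with constant
  -- `‖ψ k‖ / |α k|`. The sum dominates all of them; rows with `α k = 0` contribute `0`, by the
  -- convention on division.
  refine ⟨∑ k, ‖ψ k‖ / |α k|, Finset.sum_nonneg fun k _ => hC k, fun w hw w' hw' => ?_⟩
  rw [← h w hw]
  intro k
  have hw1 := (h w hw _).2 le_rfl k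
  have hw2 := (h w' hw' _).2 le_rfl k
  -- Epigraphs are unbounded upwards, so a positive `α k` would be violated by a large `t`.
  have hα : α k ≤ 0 := by
    by_contra! hpos
    have := (h w' hw' (max (f w') ((b k - ψ k w') / α k + 1))).2 (le_max_left _ _) k
    have h2 := mul_le_mul_of_nonneg_left
      (le_max_right (f w') ((b k - ψ k w') / α k + 1)) hpos.le
    have h3 : α k * ((b k - ψ k w') / α k + 1) = b k - ψ k w' + α k := by field_simp
    linarith
  rcases hα.lt_or_eq with hneg | hzero
  · have hle : ‖ψ k‖ / |α k| ≤ ∑ k, ‖ψ k‖ / |α k| :=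
      Finset.single_le_sum (f := fun k => ‖ψ k‖ / |α k|) (fun k _ => hC k) (Finset.mem_univ k)
    rw [div_le_iff₀ (abs_pos.2 hneg.ne), abs_of_neg hneg] at hle
    have h1 := mul_le_mul_of_nonneg_right hle (norm_nonneg (w - w'))
    have h2 := (le_abs_self _).trans ((ψ k).le_opNorm (w - w'))
    rw [map_sub] at h2
    linarith
  · simpa [hzero] using hw1

end IsPolyhedral

/-! ### Compact convex hulls and Lagrange multipliers in the plane -/

/-- In a finite-dimensional space, the convex hull of a compact set is compact. -/
theorem IsCompact.convexHull_of_finiteDimensional {E : Type*} [NormedAddCommGroup E]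
    [NormedSpace ℝ E] [FiniteDimensional ℝ E] {s : Set E} (hs : IsCompact s) :
    IsCompact (convexHull ℝ s) := by
  classical
  rcases s.eq_empty_or_nonempty with rfl | ⟨x₀, hx₀⟩
  · simp
  -- Carathéodory: at most `n` points suffice. Shorter combinations are padded with `x₀` at weight
  -- `0`, so the hull is the image of one compact set.
  let n := Module.finrank ℝ E + 1
  have hK : IsCompact ((stdSimplex ℝ (Fin n)) ×ˢ (Set.univ.pi fun _ : Fin n => s)) :=
    (isCompact_stdSimplex ℝ (Fin n)).prod (isCompact_univ_pi fun _ => hs)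
  have hcont : Continuous fun p : (Fin n → ℝ) × (Fin n → E) => ∑ i, p.1 i • p.2 i := by fun_prop
  convert hK.image hcont using 1
  apply Subset.antisymm
  · intro x hx
    obtain ⟨ι, hι, z, w, hz, hind, hw, hw1, rfl⟩ := eq_pos_convex_span_of_mem_convexHull hx
    have hcard : Fintype.card ι ≤ Fintype.card (Fin n) := by
      simpa [n] using hind.card_le_finrank_succ.trans
        (Nat.add_le_add_right (Submodule.finrank_le _) 1)
    obtain ⟨g⟩ := Function.Embedding.nonempty_of_card_le hcard
    have hext : ∀ i, Function.extend g w 0 (g i) = w i := fun i => g.injective.extend_apply _ _ i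
    have hzero : ∀ j, j ∉ Set.range g → Function.extend g w 0 j = 0 := fun j hj =>
      Function.extend_apply' _ _ _ hj
    refine ⟨(Function.extend g w 0, Function.extend g z fun _ => x₀), ⟨⟨fun j => ?_, ?_⟩, ?_⟩, ?_⟩
    · by_cases hj : j ∈ Set.range g
      · obtain ⟨i, rfl⟩ := hj
        exact (hw i).le.trans_eq (hext i).symm
      · exact (hzero j hj).ge
    · rw [← hw1]
      exact (Fintype.sum_of_injective g g.injective _ _ hzero fun i => (hext i).symm).symm
    · intro j _
      by_cases hj : j ∈ Set.range g
      · obtain ⟨i, rfl⟩ := hj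
        simp only [g.injective.extend_apply]; exact hz (mem_range_self i)
      · simpa only [Function.extend_apply' _ _ _ hj] using hx₀
    · refine (Fintype.sum_of_injective g g.injective _ _ (fun j hj => ?_) fun i => ?_).symm
      · simp [hzero j hj]
      · simp [g.injective.extend_apply]
  · rintro _ ⟨⟨w, z⟩, ⟨⟨hw0, hw1⟩, hz⟩, rfl⟩
    exact mem_convexHull_of_exists_fintype w z hw0 hw1 (fun i => hz i trivial) rfl

/-- Lagrangian duality for maximizing the second coordinate over the convex hull of a compact
subset of the plane, subject to an upper bound on the first coordinate. -/
theorem IsCompact.exists_lagrange_multiplier {G : Set (ℝ × ℝ)} (hG : IsCompact G)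
    {b₀ C ε : ℝ} (h₀ : (0, b₀) ∈ G) (hε : 0 ≤ ε)
    (hC : ∀ z ∈ G, z.2 ≤ b₀ + C * z.1) :
    ∃ v lam a : ℝ, 0 ≤ lam ∧ a ≤ ε ∧ (a, v) ∈ convexHull ℝ G ∧
      ∀ z ∈ G, z.2 - lam * z.1 ≤ v - lam * ε := by
  have hK := hG.convexHull_of_finiteDimensional
  have hsub := subset_convexHull ℝ G
  have hconv := convex_convexHull ℝ G
  obtain ⟨⟨a, v⟩, ⟨haK, haε⟩, hmax⟩ := (hK.inter_right
    (isClosed_le continuous_fst continuous_const : IsClosed {z : ℝ × ℝ | z.1 ≤ ε})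
    ).exists_isMaxOn ⟨(0, b₀), hsub h₀, hε⟩ continuous_snd.continuousOn
  have hmax' : ∀ x y : ℝ, (x, y) ∈ convexHull ℝ G → x ≤ ε → y ≤ v := fun x y h1 h2 =>
    hmax (show (x, y) ∈ convexHull ℝ G ∩ {z : ℝ × ℝ | z.1 ≤ ε} from ⟨h1, h2⟩)
  -- The segment from `z` to `z'` crosses the vertical line at `ε` at height at most `v`, so slopes
  -- from `(ε, v)` to points on the right are at most those to points on the left.
  have hcross : ∀ z ∈ G, ∀ z' ∈ G, z.1 < ε → ε < z'.1 →
      (z'.2 - v) * (ε - z.1) ≤ (v - z.2) * (z'.1 - ε) := by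
    intro z hz z' hz' h1 h2
    have hd : 0 < z'.1 - z.1 := by linarith
    have hmem := hconv (hsub hz) (hsub hz') (a := (z'.1 - ε) / (z'.1 - z.1))
      (b := (ε - z.1) / (z'.1 - z.1)) (div_nonneg (by linarith) hd.le)
      (div_nonneg (by linarith) hd.le) (by field_simp; ring)
    have := hmax' ((z'.1 - ε) / (z'.1 - z.1) * z.1 + (ε - z.1) / (z'.1 - z.1) * z'.1)
      ((z'.1 - ε) / (z'.1 - z.1) * z.2 + (ε - z.1) / (z'.1 - z.1) * z'.2) hmem
      (by apply le_of_eq; field_simp; ring)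
    rw [div_mul_eq_mul_div, div_mul_eq_mul_div, ← add_div, div_le_iff₀ hd] at this
    linarith
  -- The multiplier is the supremum of the slopes from `(ε, v)` to points on the right; inserting
  -- `0` makes it nonnegative and the set nonempty.
  let R : Set ℝ := insert 0 ((fun z : ℝ × ℝ => (z.2 - v) / (z.1 - ε)) '' (G ∩ {z | ε < z.1}))
  have hb0 : b₀ ≤ v := hmax' 0 b₀ (hsub h₀) hε
  -- For `ε > 0`, the strictly feasible point `(0, b₀)` bounds the slopes. For `ε = 0` no strictly
  -- feasible point is available, and the growth bound `hC` takes its place.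
  have hR : BddAbove R := by
    rcases hε.eq_or_lt with rfl | hpos
    · refine ⟨max 0 C, ?_⟩
      rintro _ (rfl | ⟨z, ⟨hz, hz1⟩, rfl⟩)
      · exact le_max_left _ _
      · have hz1 : 0 < z.1 := hz1
        refine le_trans ?_ (le_max_right _ _)
        simp only [sub_zero]
        rw [div_le_iff₀ hz1]
        linarith [hC z hz]
    · refine ⟨(v - b₀) / ε, ?_⟩
      rintro _ (rfl | ⟨z, ⟨hz, hz1⟩, rfl⟩)
      · exact div_nonneg (by linarith) hε
      · have hz1 : ε < z.1 := hz1
        have := hcross _ h₀ z hz hpos hz1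
        simp only [sub_zero] at this
        exact (div_le_div_iff₀ (by linarith) hpos).2 this
  refine ⟨v, sSup R, a, le_csSup hR (mem_insert _ _), haε, haK, fun z hz => ?_⟩
  rcases lt_trichotomy z.1 ε with h | h | h
  · have : sSup R ≤ (v - z.2) / (ε - z.1) := by
      refine csSup_le ⟨0, mem_insert _ _⟩ ?_
      rintro _ (rfl | ⟨z', ⟨hz', hz1⟩, rfl⟩)
      · exact div_nonneg (by linarith [hmax' z.1 z.2 (hsub hz) h.le]) (by linarith)
      · have hz1 : ε < z'.1 := hz1
        exact (div_le_div_iff₀ (by linarith) (by linarith)).2 (hcross z hz z' hz' h hz1)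
    rw [le_div_iff₀ (by linarith)] at this
    linarith
  · rw [h]
    linarith [hmax' z.1 z.2 (hsub hz) h.le]
  · have : (z.2 - v) / (z.1 - ε) ≤ sSup R := le_csSup hR (Or.inr ⟨z, ⟨hz, h⟩, rfl⟩)
    rw [div_le_iff₀ (by linarith)] at this
    linarith

/-! ### The dispatch problem: attainment, and regularity in the forecast error -/

namespace UnitCommitment

theorem abs_apply_le_oneNorm {I T : ℕ} (w : Profile I T) (i : Fin I) (t : Fin T) :
    |w i t| ≤ oneNorm w :=
  (Finset.single_le_sum (f := fun t => |w i t|) (fun _ _ => abs_nonneg _)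
    (Finset.mem_univ t)).trans
    (Finset.single_le_sum (f := fun i => ∑ t, |w i t|)
      (fun _ _ => Finset.sum_nonneg fun _ _ => abs_nonneg _) (Finset.mem_univ i))

theorem oneNorm_nonneg {I T : ℕ} (w : Profile I T) : 0 ≤ oneNorm w :=
  Finset.sum_nonneg fun _ _ => Finset.sum_nonneg fun _ _ => abs_nonneg _

theorem norm_le_oneNorm {I T : ℕ} (w : Profile I T) : ‖w‖ ≤ oneNorm w :=
  (pi_norm_le_iff_of_nonneg (oneNorm_nonneg w)).2 fun i =>
    (pi_norm_le_iff_of_nonneg (oneNorm_nonneg w)).2 fun t => abs_apply_le_oneNorm w i t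

theorem continuous_oneNorm {I T : ℕ} : Continuous (oneNorm : Profile I T → ℝ) := by
  unfold oneNorm
  fun_prop

/-- The dispatch with given generation, load shedding and curtailment. -/
def Dispatch.ofTriple {I T : ℕ} (x : Profile I T × Profile I T × Profile I T) : Dispatch I T :=
  ⟨x.1, x.2.1, x.2.2⟩

theorem Dispatch.ofTriple_surjective {I T : ℕ} :
    Function.Surjective (Dispatch.ofTriple (I := I) (T := T)) := fun x =>
  ⟨(x.gen, x.shed, x.curt), rfl⟩

namespace Data

variable {I T L S : ℕ} (D : Data I T L)

/-- `Dispatch` carries no topology, so compactness is stated for triples: closed conditions inside a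
box. -/
theorem isCompact_dispatches (r : Range I T) (w : Profile I T) :
    IsCompact (Dispatch.ofTriple ⁻¹' D.dispatches r w) := by
  have hbox : IsCompact (Icc (r.lo, (0 : Profile I T), (0 : Profile I T))
      (r.hi, D.load, D.forecast + w)) := isCompact_Icc
  refine hbox.of_isClosed_subset ?_ ?_
  · have h : Dispatch.ofTriple ⁻¹' D.dispatches r w =
        {x | (∀ i t, r.lo i t ≤ x.1 i t ∧ x.1 i t ≤ r.hi i t) ∧
          (∀ i t, 0 ≤ x.2.1 i t ∧ x.2.1 i t ≤ D.load i t) ∧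
          (∀ i t, 0 ≤ x.2.2 i t ∧ x.2.2 i t ≤ D.forecast i t + w i t) ∧
          (∀ l t, -D.lineCap l ≤ ∑ i, D.shift i l * D.injection w (.ofTriple x) i t ∧
            ∑ i, D.shift i l * D.injection w (.ofTriple x) i t ≤ D.lineCap l) ∧
          (∀ t, ∑ i, D.injection w (.ofTriple x) i t = 0)} := rfl
    simp only [h, injection, Dispatch.ofTriple]
    simp only [ofPred_and, ofPred_forall]
    repeat' first
      | refine IsClosed.inter ?_ ?_
      | refine isClosed_iInter fun _ => ?_
      | exact isClosed_le (by fun_prop) (by fun_prop)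
      | exact isClosed_eq (by fun_prop) (by fun_prop)
  · rintro ⟨g, l, c⟩ ⟨h1, h2, h3, -⟩
    exact ⟨⟨fun i t => (h1 i t).1, fun i t => (h2 i t).1, fun i t => (h3 i t).1⟩,
      ⟨fun i t => (h1 i t).2, fun i t => (h2 i t).2, fun i t => (h3 i t).2⟩⟩

theorem continuous_variableCost :
    Continuous fun x : Profile I T × Profile I T × Profile I T =>
      D.variableCost (Dispatch.ofTriple x) := by
  simp only [variableCost, Dispatch.ofTriple]
  fun_prop

theorem isLeast_dispatchCost {r : Range I T} {w : Profile I T}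
    (h : (D.dispatches r w).Nonempty) :
    IsLeast (D.variableCost '' D.dispatches r w) (D.dispatchCost r w) := by
  have himage : D.variableCost '' D.dispatches r w =
      (fun x => D.variableCost (Dispatch.ofTriple x)) ''
        (Dispatch.ofTriple ⁻¹' D.dispatches r w) := by
    conv_lhs => rw [← image_preimage_eq (D.dispatches r w) Dispatch.ofTriple_surjective]
    rw [image_image]
  have hcomp := (D.isCompact_dispatches r w).image D.continuous_variableCost
  rw [← himage] at hcomp
  exact hcomp.isLeast_sInf (h.image _)

/-- The set of triples of a forecast error, a cost bound and a feasible dispatch whose cost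
respects the bound. -/
theorem isPolyhedral_epigraph (r : Range I T) :
    IsPolyhedral {z : (Profile I T × ℝ) × (Profile I T × Profile I T × Profile I T) |
      Dispatch.ofTriple z.2 ∈ D.dispatches r z.1.1 ∧
        D.variableCost (Dispatch.ofTriple z.2) ≤ z.1.2} := by
  let Z := (Profile I T × ℝ) × (Profile I T × Profile I T × Profile I T)
  have hcoord (f : Z →ₗ[ℝ] Profile I T) (i : Fin I) (t : Fin T) :
      IsAffineFunction fun z : Z => f z i t :=
    .linear (LinearMap.proj t ∘ₗ LinearMap.proj i ∘ₗ f)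
  have hw (i : Fin I) (t : Fin T) : IsAffineFunction fun z : Z => z.1.1 i t :=
    hcoord (LinearMap.fst ℝ _ _ ∘ₗ LinearMap.fst ℝ _ _) i t
  have hg (i : Fin I) (t : Fin T) : IsAffineFunction fun z : Z => z.2.1 i t :=
    hcoord (LinearMap.fst ℝ _ _ ∘ₗ LinearMap.snd ℝ _ _) i t
  have hl (i : Fin I) (t : Fin T) : IsAffineFunction fun z : Z => z.2.2.1 i t :=
    hcoord (LinearMap.fst ℝ _ _ ∘ₗ LinearMap.snd ℝ _ _ ∘ₗ LinearMap.snd ℝ _ _) i t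
  have hc (i : Fin I) (t : Fin T) : IsAffineFunction fun z : Z => z.2.2.2 i t :=
    hcoord (LinearMap.snd ℝ _ _ ∘ₗ LinearMap.snd ℝ _ _ ∘ₗ LinearMap.snd ℝ _ _) i t
  have ht : IsAffineFunction fun z : Z => z.1.2 :=
    ⟨LinearMap.snd ℝ _ _ ∘ₗ LinearMap.fst ℝ _ _, 0, fun z => (add_zero z.1.2).symm⟩
  have hinj (i : Fin I) (t : Fin T) : IsAffineFunction fun z : Z =>
      D.injection z.1.1 (Dispatch.ofTriple z.2) i t :=
    (((((hg i t).sub (.const _)).add (hl i t)).add (.const _)).add (hw i t)).sub (hc i t)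
  have hflow (l : Fin L) (t : Fin T) : IsAffineFunction fun z : Z =>
      ∑ i, D.shift i l * D.injection z.1.1 (Dispatch.ofTriple z.2) i t :=
    .sum _ fun i => (hinj i t).const_mul _
  have hbal (t : Fin T) : IsAffineFunction fun z : Z =>
      ∑ i, D.injection z.1.1 (Dispatch.ofTriple z.2) i t :=
    .sum _ fun i => hinj i t
  have hcost : IsAffineFunction fun z : Z => D.variableCost (Dispatch.ofTriple z.2) :=
    .sum _ fun i => .sum _ fun t =>
      (((hg i t).const_mul _).add ((hl i t).const_mul _)).add ((hc i t).const_mul _)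
  refine .and (.and ?_ (.and ?_ (.and ?_ (.and ?_ ?_)))) (hcost.isPolyhedral_le ht)
  · exact .all fun i => .all fun t =>
      ((IsAffineFunction.const _).isPolyhedral_le (hg i t)).and
        ((hg i t).isPolyhedral_le (.const _))
  · exact .all fun i => .all fun t =>
      ((IsAffineFunction.const _).isPolyhedral_le (hl i t)).and
        ((hl i t).isPolyhedral_le (.const _))
  · exact .all fun i => .all fun t =>
      ((IsAffineFunction.const _).isPolyhedral_le (hc i t)).and
        ((hc i t).isPolyhedral_le ((IsAffineFunction.const _).add (hw i t)))
  · exact .all fun l => .all fun t =>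
      ((IsAffineFunction.const _).isPolyhedral_le (hflow l t)).and
        ((hflow l t).isPolyhedral_le (.const _))
  · simp only [le_antisymm_iff]
    exact .all fun t => ((hbal t).isPolyhedral_le (.const _)).and
      ((IsAffineFunction.const _).isPolyhedral_le (hbal t))

/-- Because the minimum is attained, projecting out the dispatch from the polyhedron of
`isPolyhedral_epigraph` gives exactly the epigraph over `W`. -/
theorem exists_lipschitz_dispatchCost {r : Range I T} {W : Set (Profile I T)}
    (h : ∀ w ∈ W, (D.dispatches r w).Nonempty) :
    ∃ C, ∀ w ∈ W, ∀ w' ∈ W,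
      D.dispatchCost r w ≤ D.dispatchCost r w' + C * oneNorm (w - w') := by
  obtain ⟨C, hC0, hC⟩ := (D.isPolyhedral_epigraph r).exists_mk_mem.exists_lipschitz_of_epigraph
    (W := W) (f := D.dispatchCost r) (by
      intro w hw t
      obtain ⟨⟨x, hx, hxc⟩, hmin⟩ := D.isLeast_dispatchCost (h w hw)
      constructor
      · rintro ⟨y, hy, hyt⟩
        exact (hmin ⟨_, hy, rfl⟩).trans hyt
      · intro ht
        exact ⟨(x.gen, x.shed, x.curt), hx, hxc.le.trans ht⟩)
  refine ⟨C, fun w hw w' hw' => (hC w hw w' hw').trans ?_⟩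
  gcongr
  exact norm_le_oneNorm _

theorem continuousOn_dispatchCost {r : Range I T} {W : Set (Profile I T)}
    (h : ∀ w ∈ W, (D.dispatches r w).Nonempty) : ContinuousOn (D.dispatchCost r) W := by
  obtain ⟨C, hC⟩ := D.exists_lipschitz_dispatchCost h
  intro w hw
  have hlim (f : Profile I T → ℝ) (hf : Continuous f) (h0 : f w = D.dispatchCost r w) :
      Filter.Tendsto f (nhdsWithin w W) (nhds (D.dispatchCost r w)) :=
    h0 ▸ hf.continuousAt.continuousWithinAt
  have h0 : oneNorm (0 : Profile I T) = 0 := by simp [oneNorm]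
  refine tendsto_of_tendsto_of_tendsto_of_le_of_le'
    (hlim (fun w' => D.dispatchCost r w - C * oneNorm (w - w'))
      (by have := continuous_oneNorm (I := I) (T := T); fun_prop) (by simp [h0]))
    (hlim (fun w' => D.dispatchCost r w + C * oneNorm (w' - w))
      (by have := continuous_oneNorm (I := I) (T := T); fun_prop) (by simp [h0])) ?_ ?_
  · filter_upwards [self_mem_nhdsWithin] with w' hw'
    linarith [hC w hw w' hw']
  · filter_upwards [self_mem_nhdsWithin] with w' hw'
    exact hC w' hw' w hw

variable (sample : Fin S → Profile I T) (ε β : ℝ)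

theorem isCompact_omega : IsCompact (D.omega sample ε β) := by
  have : D.omega sample ε β =
      Icc (fun i t => -D.forecast i t) (fun i t => D.capacity i - D.forecast i t) ∩
      Icc (fun i t => (⨅ s, sample s i t) - ε * max (S : ℝ) β)
        (fun i t => (⨆ s, sample s i t) + ε * max (S : ℝ) β) := by
    ext w
    simp only [omega, uncertaintySet, mem_ofPred_eq, mem_inter_iff, mem_Icc, Pi.le_def,
      forall_and]
  rw [this]
  exact isCompact_Icc.inter isCompact_Icc

variable {ε}

theorem sample_mem_omega {sample} (hsample : ∀ s, sample s ∈ D.uncertaintySet) (hε : 0 ≤ ε)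
    (s : Fin S) : sample s ∈ D.omega sample ε β := by
  -- The `S` in the maximum keeps the margin nonnegative even for negative `β`.
  have h0 : 0 ≤ ε * max (S : ℝ) β := mul_nonneg hε (le_max_of_le_left (Nat.cast_nonneg S))
  refine ⟨hsample s, fun i t => ⟨?_, ?_⟩⟩
  · linarith [ciInf_le (f := fun s => sample s i t) (Set.finite_range _).bddBelow s]
  · linarith [le_ciSup (f := fun s => sample s i t) (Set.finite_range _).bddAbove s]

end Data

end UnitCommitment

/-! ### Finitely supported measures -/

/-- The discrete measure with mass `q k` at the point `x k`. -/
noncomputable def weightedDirac {κ X : Type*} [Fintype κ] [MeasurableSpace X] (q : κ → ℝ)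
    (x : κ → X) : Measure X :=
  ∑ k, ENNReal.ofReal (q k) • Measure.dirac (x k)

section WeightedDirac

variable {κ X Y : Type*} [Fintype κ] [MeasurableSpace X] [MeasurableSpace Y] {q : κ → ℝ}
  {x : κ → X}

theorem weightedDirac_apply {s : Set X} (hs : MeasurableSet s) :
    weightedDirac q x s = ∑ k, ENNReal.ofReal (q k) * s.indicator 1 (x k) := by
  simp [weightedDirac, Measure.dirac_apply' _ hs]

theorem weightedDirac_map {g : X → Y} (hg : Measurable g) :
    (weightedDirac q x).map g = weightedDirac q (fun k => g (x k)) := by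
  ext s hs
  rw [Measure.map_apply hg hs, weightedDirac_apply (hg hs), weightedDirac_apply hs]
  rfl

theorem isProbabilityMeasure_weightedDirac (hq : ∀ k, 0 ≤ q k) (hq1 : ∑ k, q k = 1) :
    IsProbabilityMeasure (weightedDirac q x) := by
  refine ⟨?_⟩
  rw [weightedDirac_apply MeasurableSet.univ]
  simp [← ENNReal.ofReal_sum_of_nonneg fun k _ => hq k, hq1]

theorem lintegral_weightedDirac {f : X → ℝ} (hf : Measurable f) (h0 : ∀ y, 0 ≤ f y)
    (hq : ∀ k, 0 ≤ q k) :
    ∫⁻ y, ENNReal.ofReal (f y) ∂weightedDirac q x = ENNReal.ofReal (∑ k, q k * f (x k)) := by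
  rw [weightedDirac, lintegral_finsetSum_measure,
    ENNReal.ofReal_sum_of_nonneg fun k _ => mul_nonneg (hq k) (h0 _)]
  refine Finset.sum_congr rfl fun k _ => ?_
  rw [lintegral_smul_measure, lintegral_dirac' _ hf.ennreal_ofReal, smul_eq_mul,
    ENNReal.ofReal_mul (hq k)]

variable [MeasurableSingletonClass X]

/-- `f` need not be measurable: with measurable singletons, any function is almost everywhere
constant under a Dirac mass. -/
theorem integrable_weightedDirac (f : X → ℝ) : Integrable f (weightedDirac q x) :=
  integrable_finsetSum_measure.2 fun _ _ =>
    (integrable_dirac enorm_lt_top).smul_measure ENNReal.ofReal_ne_top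

theorem integral_weightedDirac (f : X → ℝ) (hq : ∀ k, 0 ≤ q k) :
    ∫ y, f y ∂weightedDirac q x = ∑ k, q k * f (x k) := by
  rw [weightedDirac, integral_finsetSum_measure fun _ _ =>
    (integrable_dirac enorm_lt_top).smul_measure ENNReal.ofReal_ne_top]
  refine Finset.sum_congr rfl fun k _ => ?_
  rw [integral_smul_measure, integral_dirac, ENNReal.toReal_ofReal (hq k), smul_eq_mul]

end WeightedDirac

/-! ### Duality for the Wasserstein ball -/

namespace UnitCommitment

variable {I T S : ℕ}

theorem empirical_eq_weightedDirac (hS : 0 < S) (sample : Fin S → Profile I T) :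
    empirical sample = weightedDirac (fun _ => 1 / (S : ℝ)) sample := by
  rw [empirical, weightedDirac, Finset.smul_sum]
  have : ENNReal.ofReal (1 / (S : ℝ)) = (S : ℝ≥0∞)⁻¹ := by
    rw [one_div, ENNReal.ofReal_inv_of_pos (by exact_mod_cast hS), ENNReal.ofReal_natCast]
  rw [this]

/-- `P` lives on the compact set `Ω`, so the values of `f` elsewhere, possibly default ones, do not
matter. -/
theorem integrable_of_mem_wassersteinBall {ε : ℝ} {P Q : Measure (Profile I T)}
    {Ω : Set (Profile I T)} {f : Profile I T → ℝ} (hP : P ∈ wassersteinBall ε Q Ω)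
    (hΩ : IsCompact Ω) (hf : ContinuousOn f Ω) : Integrable f P := by
  have := hP.1
  have h : P.restrict Ω = P := Measure.restrict_eq_self_of_ae_mem hP.2.1
  have hi : IntegrableOn f Ω P := hf.integrableOn_compact hΩ
  rwa [IntegrableOn, h] at hi

/-- Weak duality for the worst-case expectation over a Wasserstein ball. -/
theorem integral_le_of_mem_wassersteinBall (hS : 0 < S) {sample : Fin S → Profile I T} {ε : ℝ}
    (hε : 0 ≤ ε) {P : Measure (Profile I T)} {Ω : Set (Profile I T)} {f : Profile I T → ℝ}
    (hP : P ∈ wassersteinBall ε (empirical sample) Ω) (hf : Integrable f P)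
    (hΩ : Ω.Nonempty) {lam : ℝ} (hlam : 0 ≤ lam) {η : Fin S → ℝ}
    (hη : ∀ s, ∀ w ∈ Ω, f w - lam * oneNorm (w - sample s) ≤ η s) :
    ∫ w, f w ∂P ≤ lam * ε + 1 / (S : ℝ) * ∑ s, η s := by
  obtain ⟨hprob, hsupp, hdist⟩ := hP
  have hS0 : (0 : ℝ) ≤ 1 / (S : ℝ) := by positivity
  -- The smallest admissible `η`, extended to a function on the whole space so that it can be
  -- integrated against the second marginal, even if samples coincide.
  let h : Profile I T → ℝ := fun z => sSup ((fun w => f w - lam * oneNorm (w - z)) '' Ω)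
  have hhη : ∀ s, h (sample s) ≤ η s := fun s =>
    csSup_le (hΩ.image _) (by rintro _ ⟨w, hw, rfl⟩; exact hη s w hw)
  have hle : ∀ s, ∀ w ∈ Ω, f w ≤ lam * oneNorm (w - sample s) + h (sample s) := by
    intro s w hw
    have : f w - lam * oneNorm (w - sample s) ≤ h (sample s) :=
      le_csSup ⟨η s, by rintro _ ⟨w, hw, rfl⟩; exact hη s w hw⟩ ⟨w, hw, rfl⟩
    linarith
  -- An optimal coupling is not needed: one of cost below `ε + δ` exists, and `δ` tends to `0` at
  -- the end.
  have hbound : ∀ δ : ℝ, 0 < δ →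
      ∫ w, f w ∂P ≤ lam * (ε + δ) + 1 / (S : ℝ) * ∑ s, η s := by
    intro δ hδ
    have hlt : wassersteinDist P (empirical sample) < ENNReal.ofReal (ε + δ) :=
      hdist.trans_lt ((ENNReal.ofReal_lt_ofReal_iff (by linarith)).2 (by linarith))
    simp only [wassersteinDist, iInf_lt_iff] at hlt
    obtain ⟨π, ⟨hπ1, hπ2⟩, hπ⟩ := hlt
    have hcm : Continuous fun z : Profile I T × Profile I T => oneNorm (z.1 - z.2) :=
      continuous_oneNorm.comp (continuous_fst.sub continuous_snd)
    have hcost_int : Integrable (fun z : Profile I T × Profile I T => oneNorm (z.1 - z.2)) π := by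
      refine ⟨hcm.aestronglyMeasurable, ?_⟩
      rw [hasFiniteIntegral_iff_ofReal (Filter.Eventually.of_forall fun _ => oneNorm_nonneg _)]
      exact hπ.trans ENNReal.ofReal_lt_top
    have hcost : ∫ z, oneNorm (z.1 - z.2) ∂π ≤ ε + δ := by
      rw [← ENNReal.ofReal_le_ofReal_iff (by linarith), ofReal_integral_eq_lintegral_ofReal
        hcost_int (Filter.Eventually.of_forall fun _ => oneNorm_nonneg _)]
      exact hπ.le
    have hf1 : Integrable f (π.map Prod.fst) := hπ1 ▸ hf
    have hh2 : Integrable h (π.map Prod.snd) := by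
      rw [hπ2, empirical_eq_weightedDirac hS]
      exact integrable_weightedDirac h
    have hfst : ∫ z, f z.1 ∂π = ∫ w, f w ∂P := by
      rw [← hπ1, integral_map measurable_fst.aemeasurable hf1.aestronglyMeasurable]
    have hsnd : ∫ z, h z.2 ∂π = ∑ s, 1 / (S : ℝ) * h (sample s) := by
      rw [← integral_map measurable_snd.aemeasurable hh2.aestronglyMeasurable, hπ2,
        empirical_eq_weightedDirac hS, integral_weightedDirac h fun _ => hS0]
    have hae1 : ∀ᵐ z ∂π, z.1 ∈ Ω := by
      refine ae_of_ae_map measurable_fst.aemeasurable ?_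
      rw [hπ1]
      exact hsupp
    have hae2 : ∀ᵐ z ∂π, z.2 ∈ Set.range sample := by
      refine ae_of_ae_map measurable_snd.aemeasurable ?_
      rw [hπ2, ae_iff, empirical_eq_weightedDirac hS]
      change weightedDirac _ _ (Set.range sample)ᶜ = 0
      rw [weightedDirac_apply (Set.finite_range sample).measurableSet.compl]
      simp
    have hf1' : Integrable (fun z : Profile I T × Profile I T => f z.1) π :=
      hf1.comp_measurable measurable_fst
    have hh2' : Integrable (fun z : Profile I T × Profile I T => h z.2) π :=
      hh2.comp_measurable measurable_snd
    calc ∫ w, f w ∂P = ∫ z, f z.1 ∂π := hfst.symm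
      _ ≤ ∫ z, (lam * oneNorm (z.1 - z.2) + h z.2) ∂π := by
          refine integral_mono_ae hf1' ((hcost_int.const_mul lam).add hh2') ?_
          filter_upwards [hae1, hae2] with z hz1 hz2
          obtain ⟨s, hs⟩ := hz2
          rw [← hs]
          exact hle s _ hz1
      _ = lam * ∫ z, oneNorm (z.1 - z.2) ∂π + ∑ s, 1 / (S : ℝ) * h (sample s) := by
          rw [integral_add (hcost_int.const_mul lam) hh2', integral_const_mul, hsnd]
      _ ≤ lam * (ε + δ) + 1 / (S : ℝ) * ∑ s, η s := by
          rw [← Finset.mul_sum]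
          gcongr with s
          exact hhη s
  refine le_of_forall_pos_le_add fun γ hγ => ?_
  -- The denominator `lam + 1` covers `lam = 0` as well.
  have h1 := hbound (γ / (lam + 1)) (by positivity)
  have h2 : lam * (γ / (lam + 1)) ≤ γ := by
    rw [mul_div_assoc', div_le_iff₀ (by linarith)]
    nlinarith
  linarith

/-- The mixtures of uniform distributions on scenarios lie in the Wasserstein ball as soon as
their mean transport cost is bounded by its radius. -/
theorem exists_mem_wassersteinBall (hS : 0 < S) {sample : Fin S → Profile I T} {ε : ℝ}
    {Ω : Set (Profile I T)} (hΩ : MeasurableSet Ω) {κ : Type*} [Fintype κ] {q : κ → ℝ}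
    (hq : ∀ k, 0 ≤ q k) (hq1 : ∑ k, q k = 1) {x : κ → Fin S → Profile I T}
    (hx : ∀ k s, x k s ∈ Ω)
    (hcost : ∑ k, q k * (1 / (S : ℝ) * ∑ s, oneNorm (x k s - sample s)) ≤ ε)
    (f : Profile I T → ℝ) :
    ∃ P ∈ wassersteinBall ε (empirical sample) Ω,
      ∫ w, f w ∂P = ∑ k, q k * (1 / (S : ℝ) * ∑ s, f (x k s)) := by
  have hSne : (S : ℝ) ≠ 0 := by exact_mod_cast hS.ne'
  let p : κ × Fin S → ℝ := fun k => q k.1 * (1 / (S : ℝ))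
  have hp : ∀ k, 0 ≤ p k := fun k => mul_nonneg (hq _) (by positivity)
  have hsum (g : κ → Fin S → ℝ) :
      ∑ k, p k * g k.1 k.2 = ∑ k, q k * (1 / (S : ℝ) * ∑ s, g k s) := by
    simp only [Fintype.sum_prod_type, Finset.mul_sum, p, mul_assoc]
  have hp1 : ∑ k, p k = 1 := by
    have := hsum fun _ _ => 1
    simp only [mul_one] at this
    rw [this]
    simp [hSne, hq1]
  refine ⟨weightedDirac p fun k => x k.1 k.2,
    ⟨isProbabilityMeasure_weightedDirac hp hp1, ?_, ?_⟩, ?_⟩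
  · rw [weightedDirac_apply hΩ.compl]
    simp [hx]
  -- The coupling transports each atom `x k s` to `sample s`; its second marginal is the empirical
  -- distribution because the `q k` sum to `1`.
  · refine (iInf₂_le (weightedDirac p fun k => (x k.1 k.2, sample k.2)) ?_).trans ?_
    · constructor
      · rw [weightedDirac_map measurable_fst]
      · rw [weightedDirac_map measurable_snd, empirical_eq_weightedDirac hS]
        simp only [weightedDirac, Fintype.sum_prod_type, p]
        rw [Finset.sum_comm]
        refine Finset.sum_congr rfl fun s _ => ?_
        rw [← Finset.sum_smul, ← ENNReal.ofReal_sum_of_nonneg fun k _ => hp (k, s),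
          ← Finset.sum_mul, hq1, one_mul]
    · rw [lintegral_weightedDirac (f := fun z : Profile I T × Profile I T => oneNorm (z.1 - z.2))
        (continuous_oneNorm.comp (continuous_fst.sub continuous_snd)).measurable
        (fun _ => oneNorm_nonneg _) hp]
      refine ENNReal.ofReal_le_ofReal ?_
      rwa [hsum fun k s => oneNorm (x k s - sample s)]
  · rw [integral_weightedDirac f hp, hsum fun k s => f (x k s)]

/-- Strong duality for the worst-case expectation of a Lipschitz function over a Wasserstein
ball around an empirical distribution; both optima are attained. -/
theorem exists_wassersteinBall_strong_duality (hS : 0 < S) {sample : Fin S → Profile I T}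
    {ε : ℝ} (hε : 0 ≤ ε) {Ω : Set (Profile I T)} (hΩ : IsCompact Ω)
    (hsample : ∀ s, sample s ∈ Ω) {f : Profile I T → ℝ} (hf : ContinuousOn f Ω) {C : ℝ}
    (hC : ∀ w ∈ Ω, ∀ w' ∈ Ω, f w ≤ f w' + C * oneNorm (w - w')) :
    ∃ P ∈ wassersteinBall ε (empirical sample) Ω, ∃ (lam : ℝ) (η : Fin S → ℝ), 0 ≤ lam ∧
      (∀ s, ∀ w ∈ Ω, f w - lam * oneNorm (w - sample s) ≤ η s) ∧
      ∫ w, f w ∂P = lam * ε + 1 / (S : ℝ) * ∑ s, η s := by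
  have hS0 : (0 : ℝ) ≤ 1 / (S : ℝ) := by positivity
  let K : Set (Fin S → Profile I T) := Set.univ.pi fun _ => Ω
  have hK : IsCompact K := isCompact_univ_pi fun _ => hΩ
  let Φ : (Fin S → Profile I T) → ℝ × ℝ := fun x =>
    (1 / (S : ℝ) * ∑ s, oneNorm (x s - sample s), 1 / (S : ℝ) * ∑ s, f (x s))
  have hcont : ContinuousOn Φ K := by
    refine ContinuousOn.prodMk ?_ ?_
    · have := continuous_oneNorm (I := I) (T := T)
      exact Continuous.continuousOn (by fun_prop)
    · refine continuousOn_const.mul (continuousOn_finsetSum _ fun s _ => ?_)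
      exact hf.comp (continuous_apply s).continuousOn fun x hx => hx s trivial
  have hzero : Φ sample = (0, 1 / (S : ℝ) * ∑ s, f (sample s)) := by
    simp [Φ, oneNorm]
  obtain ⟨v, lam, a, hlam, ha, hmem, hle⟩ :=
    (hK.image_of_continuousOn hcont).exists_lagrange_multiplier (C := C)
    (hzero ▸ ⟨sample, fun s _ => hsample s, rfl⟩ :
      (0, 1 / (S : ℝ) * ∑ s, f (sample s)) ∈ Φ '' K) hε (by
      rintro _ ⟨x, hx, rfl⟩
      have : ∑ s, f (x s) ≤ ∑ s, (f (sample s) + C * oneNorm (x s - sample s)) :=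
        Finset.sum_le_sum fun s _ => hC _ (hx s trivial) _ (hsample s)
      rw [Finset.sum_add_distrib, ← Finset.mul_sum] at this
      have := mul_le_mul_of_nonneg_left this hS0
      simp only [Φ]
      linarith)
  rw [mem_convexHull_iff_exists_fintype] at hmem
  obtain ⟨κ, _, q, z, hq, hq1, hz, hqz⟩ := hmem
  choose x hx hxz using hz
  have hfst : ∑ k, q k * (1 / (S : ℝ) * ∑ s, oneNorm (x k s - sample s)) = a := by
    have := congrArg Prod.fst hqz
    simpa [Prod.fst_sum, ← hxz, Φ] using this
  have hsnd : ∑ k, q k * (1 / (S : ℝ) * ∑ s, f (x k s)) = v := by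
    have := congrArg Prod.snd hqz
    simpa [Prod.snd_sum, ← hxz, Φ] using this
  obtain ⟨P, hP, hPv⟩ := exists_mem_wassersteinBall hS (sample := sample) hΩ.measurableSet hq hq1
    (fun k s => hx k s trivial) (hfst.trans_le ha) f
  -- For fixed `lam`, the best `η s` is the maximum over `Ω` of the penalized cost.
  have hmax : ∀ s, ∃ w ∈ Ω, ∀ w' ∈ Ω,
      f w' - lam * oneNorm (w' - sample s) ≤ f w - lam * oneNorm (w - sample s) := by
    intro s
    have hcont' : ContinuousOn (fun w => f w - lam * oneNorm (w - sample s)) Ω := by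
      have := continuous_oneNorm (I := I) (T := T)
      exact hf.sub (Continuous.continuousOn (by fun_prop))
    exact hΩ.exists_isMaxOn ⟨_, hsample s⟩ hcont'
  choose y hy hymax using hmax
  have hη : ∀ s, ∀ w ∈ Ω, f w - lam * oneNorm (w - sample s) ≤
      f (y s) - lam * oneNorm (y s - sample s) := hymax
  refine ⟨P, hP, lam, _, hlam, hη, le_antisymm ?_ ?_⟩
  · exact integral_le_of_mem_wassersteinBall hS hε hP
      (integrable_of_mem_wassersteinBall hP hΩ hf) ⟨_, hsample ⟨0, hS⟩⟩ hlam hη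
  -- The multiplier inequality is tested at the scenario made of all the maximizers `y s` at once,
  -- which lies in `K` because `K` is a product.
  · have := hle _ ⟨y, fun s _ => hy s, rfl⟩
    simp only [Φ] at this
    rw [hPv, hsnd, Finset.sum_sub_distrib, ← Finset.mul_sum]
    linarith

end UnitCommitment

/-! ### Equivalence of the two problems -/

namespace UnitCommitment.Data

variable {I T L S : ℕ} (D : Data I T L)

/-- The worst-case expected dispatch cost is a maximum and equals the minimum of the
multiplier costs. -/
theorem isGreatest_expectedCosts_and_isLeast_multiplierCost (hS : 0 < S)
    {sample : Fin S → Profile I T} (hsample : ∀ s, sample s ∈ D.uncertaintySet)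
    {ε : ℝ} (hε : 0 ≤ ε) (β : ℝ) {r : Range I T}
    (hr : ∀ w ∈ D.uncertaintySet, (D.dispatches r w).Nonempty) :
    IsGreatest (D.expectedCosts sample ε β r) (sSup (D.expectedCosts sample ε β r)) ∧
      IsLeast (multiplierCost ε '' D.multipliers sample ε β r)
        (sSup (D.expectedCosts sample ε β r)) := by
  have hΩ := D.isCompact_omega sample ε β
  have hmem := D.sample_mem_omega β hsample hε
  have hr' : ∀ w ∈ D.omega sample ε β, (D.dispatches r w).Nonempty := fun w hw => hr w hw.1
  have hcont := D.continuousOn_dispatchCost hr'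
  obtain ⟨C, hC⟩ := D.exists_lipschitz_dispatchCost hr'
  have hweak : ∀ P ∈ D.ambiguitySet sample ε β, ∀ m ∈ D.multipliers sample ε β r,
      ∫ w, D.dispatchCost r w ∂P ≤ multiplierCost ε m := fun P hP m hm =>
    integral_le_of_mem_wassersteinBall hS hε hP
      (integrable_of_mem_wassersteinBall hP hΩ hcont) ⟨_, hmem ⟨0, hS⟩⟩ hm.1 hm.2
  obtain ⟨P, hP, lam, η, hlam, hη, heq⟩ :=
    exists_wassersteinBall_strong_duality hS hε hΩ hmem hcont hC
  have hm : (lam, η) ∈ D.multipliers sample ε β r := ⟨hlam, hη⟩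
  have hgreatest : IsGreatest (D.expectedCosts sample ε β r) (∫ w, D.dispatchCost r w ∂P) := by
    refine ⟨⟨P, hP, rfl⟩, ?_⟩
    rintro _ ⟨P', hP', rfl⟩
    exact (hweak P' hP' _ hm).trans_eq heq.symm
  rw [hgreatest.csSup_eq]
  refine ⟨hgreatest, ⟨_, hm, heq.symm⟩, ?_⟩
  rintro _ ⟨m, hm', rfl⟩
  exact hweak P hP m hm'

end UnitCommitment.Data

theorem proposition1 {I T L S : ℕ} (hS : 0 < S) (D : UnitCommitment.Data I T L)
    (sample : Fin S → UnitCommitment.Profile I T)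
    (hsample : ∀ s, sample s ∈ D.uncertaintySet)
    (ε β : ℝ) (hε : 0 ≤ ε) :
    -- at a feasible point, every minimum, maximum and expectation is well defined, and the
    -- worst-case expected cost is the minimum over the multipliers
    (∀ p ∈ D.drFeasible,
      (∀ w ∈ D.uncertaintySet,
        IsLeast (D.variableCost '' D.dispatches p.2 w) (D.dispatchCost p.2 w)) ∧
      (∀ P ∈ D.ambiguitySet sample ε β, Integrable (D.dispatchCost p.2) P) ∧
      IsGreatest (D.expectedCosts sample ε β p.2) (sSup (D.expectedCosts sample ε β p.2)) ∧
      IsLeast (UnitCommitment.Data.multiplierCost ε '' D.multipliers sample ε β p.2)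
        (sSup (D.expectedCosts sample ε β p.2))) ∧
    -- the two problems have the same optimal value (`⊤` if they are infeasible)
    (⨅ p ∈ D.drFeasible, (D.drObjective sample ε β p : EReal)) =
      (⨅ q ∈ D.roFeasible sample ε β, (D.roObjective ε q : EReal)) ∧
    -- the two problems have the same feasible points and the same optimal solutions
    (∀ p, p ∈ D.drFeasible ↔ ∃ m, (p, m) ∈ D.roFeasible sample ε β) ∧
    (∀ p, (p ∈ D.drFeasible ∧ IsMinOn (D.drObjective sample ε β) D.drFeasible p) ↔
      ∃ m, (p, m) ∈ D.roFeasible sample ε β ∧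
        IsMinOn (D.roObjective ε) (D.roFeasible sample ε β) (p, m)) := by
  have hdual := fun p (hp : p ∈ D.drFeasible) =>
    D.isGreatest_expectedCosts_and_isLeast_multiplierCost hS hsample hε β hp.2.2
  -- Attainment of the inner minimum lifts points of (A) to (B) at equal value, and projecting back
  -- (`hproj`) never increases the value. The statements on optimal values, feasibility and
  -- minimizers all follow from these two facts.
  have hlift : ∀ p ∈ D.drFeasible, ∃ m, (p, m) ∈ D.roFeasible sample ε β ∧
      D.roObjective ε (p, m) = D.drObjective sample ε β p := by
    intro p hp
    obtain ⟨m, hm, hmeq⟩ := (hdual p hp).2.1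
    exact ⟨m, ⟨hp.1, hp.2, hm⟩, congrArg (D.fixedCost p.1 + ·) hmeq⟩
  have hproj : ∀ q ∈ D.roFeasible sample ε β, q.1 ∈ D.drFeasible ∧
      D.drObjective sample ε β q.1 ≤ D.roObjective ε q := by
    intro q hq
    have hp : q.1 ∈ D.drFeasible := ⟨hq.1, hq.2.1⟩
    exact ⟨hp, add_le_add le_rfl ((hdual q.1 hp).2.2 ⟨q.2, hq.2.2, rfl⟩)⟩
  refine ⟨fun p hp => ⟨fun w hw => D.isLeast_dispatchCost (hp.2.2 w hw), fun P hP => ?_,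
    hdual p hp⟩, le_antisymm ?_ ?_, fun p => ⟨fun hp => ?_, ?_⟩, fun p => ⟨?_, ?_⟩⟩
  · exact UnitCommitment.integrable_of_mem_wassersteinBall hP (D.isCompact_omega sample ε β)
      (D.continuousOn_dispatchCost fun w hw => hp.2.2 w hw.1)
  · refine le_iInf₂ fun q hq => (iInf₂_le q.1 (hproj q hq).1).trans ?_
    exact EReal.coe_le_coe_iff.2 (hproj q hq).2
  · refine le_iInf₂ fun p hp => ?_
    obtain ⟨m, hm, hmeq⟩ := hlift p hp
    exact (iInf₂_le (p, m) hm).trans_eq (congrArg _ hmeq)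
  · obtain ⟨m, hm, -⟩ := hlift p hp
    exact ⟨m, hm⟩
  · rintro ⟨m, hm⟩
    exact (hproj _ hm).1
  · rintro ⟨hp, hmin⟩
    obtain ⟨m, hm, hmeq⟩ := hlift p hp
    exact ⟨m, hm, fun q hq =>
      hmeq.trans_le ((isMinOn_iff.1 hmin _ (hproj q hq).1).trans (hproj q hq).2)⟩
  · rintro ⟨m, hm, hmin⟩
    refine ⟨(hproj _ hm).1, fun p' hp' => ?_⟩
    obtain ⟨m', hm', hmeq⟩ := hlift p' hp'
    exact (hproj _ hm).2.trans ((isMinOn_iff.1 hmin _ hm').trans_eq hmeq)
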